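/- Let $E$ be a field of characteristic $0$, let $Q$ be a central quaternion division algebra over $E$ with its conjugation involution $\bar{\ }$, and let $(V,h)$ and $(V',h')$ be finite-dimensional skew-hermitian spaces over $Q$ with respect to $\bar{\ }$. Let $\widehat E=E((t))$ be the field of Laurent series in one indeterminate over $E$, let $\widehat Q=\widehat E\otimes_E Q$ (with conjugation $\mathrm{id}\otimes\bar{\ }$), and let $(\widehat V,\widehat h)$ and $(\widehat V',\widehat h')$ be the skew-hermitian spaces over $\widehat Q$ obtained from $(V,h)$ and $(V',h')$ by extending scalars from $E$ to $\widehat E$. Put $$(W,h_W)=\bigl(\widehat V\oplus\widehat V',\ \widehat h\perp\langle t\rangle\widehat h'\bigr),$$ that is, $h_W(x_1+x_1',x_2+x_2')=\widehat h(x_1,x_2)+t\,\widehat h'(x_1',x_2')$. A form $h$ is anisotropic if $h(x,x)=0$ only for $x=0$; $h$ and $h'$ are similar if $h'$ is isometric to $\mu h$ for some $\mu\in E^\times$; and $\operatorname{ad}_h(g)=g$ means that $h(g(x),y)=h(x,g(y))$ for all $x,y$. 1. If $h$ and $h'$ are anisotropic, then $h_W$ is anisotropic. 2. Assume that $h$ and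 $h'$ are anisotropic and not similar. If $\widehat g\in\operatorname{End}_{\widehat Q}W$ satisfies $\operatorname{ad}_{h_W}(\widehat g)=\widehat g$ and $\widehat g^2=\lambda$ for some $\lambda\in\widehat E^\times$, then there exist $\lambda_0\in E^\times$, $g\in\operatorname{End}_QV$ and $g'\in\operatorname{End}_QV'$ such that $\lambda\in\lambda_0\widehat E^{\times 2}$, $\operatorname{ad}_h(g)=g$, $\operatorname{ad}_{h'}(g')=g'$ and $g^2=g'^2=\lambda_0$. -/

import Mathlib

open scoped TensorProduct Quaternion LaurentSeries

noncomputable section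

/-- The conjugation of the quaternion algebra `Q` over `F`, computed through an identification `φ`
of `Q` with the algebra `(a, b)_F` having the standard basis `1, i, j, ij`, `i² = a`, `j² = b`,
`ij = -ji`. (It does not depend on the identification.) -/
def quatConj {F Q : Type*} [Field F] [Ring Q] [Algebra F Q] {a b : F}
    (φ : Q ≃ₐ[F] ℍ[F, a, b]) : Q →ₗ[F] Q where
  toFun x := φ.symm (star (φ x))
  map_add' x y := by simp
  map_smul' r x := by simp

/-- The field `E((t))` as an `E`-algebra through the constant series. -/
instance laurentAlgebra (E : Type*) [Field E] : Algebra E E⸨X⸩ := HahnSeries.instAlgebra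

theorem laurentAlgebra_algebraMap {E : Type*} [Field E] (c : E) :
    algebraMap E E⸨X⸩ c = HahnSeries.C c := rfl

/-- The scalar extension `M_K = K ⊗ M` of an `F`-module (or `F`-algebra) `M` along `F → K`. -/
abbrev ScalarExt (F K M : Type*) [CommRing F] [CommRing K] [Algebra F K] [AddCommGroup M]
    [Module F M] : Type _ := K ⊗[F] M

section ScalarExtension

variable {F K D V : Type*} [CommRing F] [CommRing K] [Algebra F K] [Ring D] [Algebra F D]
  [AddCommGroup V] [Module F V] [Module D V] [IsScalarTower F D V]

/-- Scalar extension of a `D`-module `V` from `F` to `K`: the `K`-algebra `K ⊗ D` acts on `K ⊗ V`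
by `(k ⊗ d) • (l ⊗ x) = kl ⊗ dx`. -/
instance scalarExtModule : Module (K ⊗[F] D) (K ⊗[F] V) :=
  Module.compHom (K ⊗[F] V)
    ((Module.endTensorEndAlgHom (R := F) (S := F) (A := K) (M := K) (N := V)).comp
      (Algebra.TensorProduct.map (Algebra.lsmul F K K) (Algebra.lsmul F F V))).toRingHom

theorem scalarExt_tmul_smul_tmul (k l : K) (d : D) (x : V) :
    (k ⊗ₜ[F] d) • (l ⊗ₜ[F] x) = (k * l) ⊗ₜ[F] (d • x) := rfl

instance scalarExtIsScalarTower : IsScalarTower K (K ⊗[F] D) (K ⊗[F] V) where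
  smul_assoc k c v := by
    induction c with
    | zero => simp
    | add c c' hc hc' => simp only [smul_add, add_smul, hc, hc']
    | tmul l d =>
      induction v with
      | zero => simp
      | add v v' hv hv' => simp only [smul_add, hv, hv']
      | tmul m x =>
        simp only [TensorProduct.smul_tmul', scalarExt_tmul_smul_tmul, smul_eq_mul, mul_assoc]

end ScalarExtension

/-- A skew-hermitian form on the (left) `D`-module `V` with respect to an `F`-linear involution `σ`
of the `F`-algebra `D`: it is biadditive and
`h(dx, y) = d h(x, y)`, `h(x, dy) = h(x, y) σ(d)`, `h(y, x) = -σ(h(x, y))`.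
The values are recorded as an `F`-bilinear map. -/
structure SkewHermitianForm (F : Type*) {D : Type*} (V : Type*) [CommRing F] [Ring D]
    [Algebra F D] [AddCommGroup V] [Module F V] [Module D V] (σ : D →ₗ[F] D) where
  form : V →ₗ[F] V →ₗ[F] D
  smul_left : ∀ (d : D) (x y : V), form (d • x) y = d * form x y
  smul_right : ∀ (d : D) (x y : V), form x (d • y) = form x y * σ d
  skew : ∀ x y : V, form y x = -σ (form x y)

namespace SkewHermitianForm

section Basic

variable {F D V V' : Type*} [CommRing F] [Ring D] [Algebra F D] {σ : D →ₗ[F] D}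
  [AddCommGroup V] [Module F V] [Module D V]
  [AddCommGroup V'] [Module F V'] [Module D V']

/-- `h` is anisotropic: `h(x, x) = 0` only for `x = 0`. -/
def Anisotropic (h : SkewHermitianForm F V σ) : Prop :=
  ∀ x : V, h.form x x = 0 → x = 0

/-- `ad_h(g) = g`: the `D`-endomorphism `g` is its own adjoint with respect to `h`. -/
def AdSymmetric (h : SkewHermitianForm F V σ) (g : Module.End D V) : Prop :=
  ∀ x y : V, h.form (g x) y = h.form x (g y)

/-- `⟨μ⟩h`, the form `h` multiplied by the scalar `μ`. -/
def scale (μ : F) (h : SkewHermitianForm F V σ) : SkewHermitianForm F V σ where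
  form := μ • h.form
  smul_left d x y := by simp [h.smul_left]
  smul_right d x y := by simp [h.smul_right]
  skew x y := by simp [h.skew x y]

/-- Isometry of forms. -/
def Isometric (h : SkewHermitianForm F V σ) (h' : SkewHermitianForm F V' σ) : Prop :=
  ∃ f : V ≃ₗ[D] V', ∀ x y : V, h'.form (f x) (f y) = h.form x y

/-- `h` and `h'` are similar: `h' ≃ ⟨μ⟩h` for some invertible scalar `μ` of `F`. -/
def Similar (h : SkewHermitianForm F V σ) (h' : SkewHermitianForm F V' σ) : Prop :=
  ∃ μ : Fˣ, Isometric (scale (μ : F) h) h'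

/-- The orthogonal sum `h ⊥ h'` on `V ⊕ V'`. -/
def orthSum (h : SkewHermitianForm F V σ) (h' : SkewHermitianForm F V' σ) :
    SkewHermitianForm F (V × V') σ where
  form := h.form.compl₁₂ (LinearMap.fst F V V') (LinearMap.fst F V V')
    + h'.form.compl₁₂ (LinearMap.snd F V V') (LinearMap.snd F V V')
  smul_left d x y := by simp [h.smul_left, h'.smul_left, mul_add]
  smul_right d x y := by simp [h.smul_right, h'.smul_right, add_mul]
  skew x y := by simp [h.skew x.1 y.1, h'.skew x.2 y.2, add_comm]

theorem orthSum_apply (h : SkewHermitianForm F V σ) (h' : SkewHermitianForm F V' σ)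
    (w₁ w₂ : V × V') :
    (orthSum h h').form w₁ w₂ = h.form w₁.1 w₂.1 + h'.form w₁.2 w₂.2 := rfl

end Basic

section Extension

variable {F D V : Type*} (K : Type*) [CommRing F] [CommRing K] [Algebra F K] [Ring D]
  [Algebra F D] {σ : D →ₗ[F] D}
  [AddCommGroup V] [Module F V] [Module D V] [IsScalarTower F D V]

/-- The form `h_K` on `K ⊗ V` obtained from `h` by extending scalars from `F` to `K`:
`h_K(k ⊗ x, l ⊗ y) = kl ⊗ h(x, y)`. It is skew-hermitian for the involution `id ⊗ σ` of `K ⊗ D`. -/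
def extendScalars (h : SkewHermitianForm F V σ) :
    SkewHermitianForm K (D := K ⊗[F] D) (K ⊗[F] V) (σ.baseChange K) where
  form := LinearMap.BilinMap.baseChange K h.form
  smul_left d x y := by
    induction d with
    | zero => simp
    | add d d' hd hd' => simp only [add_smul, map_add, LinearMap.add_apply, hd, hd', add_mul]
    | tmul k d =>
      induction x with
      | zero => simp
      | add x x' hx hx' => simp only [smul_add, map_add, LinearMap.add_apply, hx, hx', mul_add]
      | tmul l x =>
        induction y with
        | zero => simp
        | add y y' hy hy' => simp only [map_add, hy, hy', mul_add]
        | tmul m y =>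
          simp only [scalarExt_tmul_smul_tmul, LinearMap.BilinMap.baseChange_tmul, h.smul_left,
            Algebra.TensorProduct.tmul_mul_tmul, mul_assoc]
  smul_right d x y := by
    induction d with
    | zero => simp
    | add d d' hd hd' => simp only [add_smul, map_add, hd, hd', mul_add]
    | tmul k d =>
      induction x with
      | zero => simp
      | add x x' hx hx' => simp only [map_add, LinearMap.add_apply, hx, hx', add_mul]
      | tmul l x =>
        induction y with
        | zero => simp
        | add y y' hy hy' => simp only [smul_add, map_add, hy, hy', add_mul]
        | tmul m y =>
          simp only [scalarExt_tmul_smul_tmul, LinearMap.BilinMap.baseChange_tmul, h.smul_right,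
            Algebra.TensorProduct.tmul_mul_tmul, LinearMap.baseChange_tmul]
          congr 1
          ring
  skew x y := by
    induction x with
    | zero => simp
    | add x x' hx hx' =>
      simp only [map_add, LinearMap.add_apply, hx, hx', neg_add]
    | tmul l x =>
      induction y with
      | zero => simp
      | add y y' hy hy' => simp only [map_add, LinearMap.add_apply, hy, hy', neg_add]
      | tmul m y =>
        simp only [LinearMap.BilinMap.baseChange_tmul, LinearMap.baseChange_tmul]
        rw [h.skew x y, TensorProduct.tmul_neg, mul_comm]

end Extension

/-- The form `h_W = ĥ ⊥ ⟨t⟩ĥ'` on `W = V̂ ⊕ V̂'` over `E((t))`. -/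
def laurentSum {E D V V' : Type*} [Field E] [Ring D] [Algebra E D] {σ : D →ₗ[E] D}
    [AddCommGroup V] [Module E V] [Module D V] [IsScalarTower E D V]
    [AddCommGroup V'] [Module E V'] [Module D V'] [IsScalarTower E D V']
    (h : SkewHermitianForm E V σ) (h' : SkewHermitianForm E V' σ) :
    SkewHermitianForm E⸨X⸩ (D := ScalarExt E E⸨X⸩ D) (ScalarExt E E⸨X⸩ V × ScalarExt E E⸨X⸩ V')
      (σ.baseChange E⸨X⸩) :=
  orthSum (extendScalars E⸨X⸩ h)
    (scale (HahnSeries.single (1 : ℤ) (1 : E)) (extendScalars E⸨X⸩ h'))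

end SkewHermitianForm

end

open scoped TensorProduct LaurentSeries

noncomputable section

/-! Filter `W` by giving a coefficient at `t ^ j` level `2j` in the first summand and `2j + 1` in
the second; the graded pieces are copies of `V` (even levels) and `V'` (odd levels). On the piece of
level `n`, the coefficient of `h_W(w, w)` at `t ^ n` is the value of `h` or `h'` at the leading
coefficient of `w`. If both forms are anisotropic, the level of `w` can therefore be read off from
the order of `h_W(w, w)` (`filt_of_tcoeff_laurentSum_eq_zero`), and `h_W` is anisotropic.

A symmetric `g` with `g² = λ` multiplies `h_W` by `λ`, so it raises levels by the order `m` of `λ`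
(`filt_apply`) and induces graded maps. If `m` is odd, these exchange `V` and `V'` and form a
similitude (`similar_of_order_odd`), which is excluded. If `m` is even, they preserve `V` and `V'`,
are symmetric, and square to the leading coefficient `λ₀` of `λ`
(`exists_adSymmetric_of_order_even`); by Hensel's lemma `λ` is `λ₀` times a square. -/

namespace LaurentSeries

variable {E : Type*} [Field E]

/-! ### Square classes of Laurent series -/

/-- A power series with constant coefficient `1` is a square in characteristic `0`. -/
theorem exists_sq_eq_of_constantCoeff_eq_one [CharZero E] (u : PowerSeries E)
    (hu : PowerSeries.constantCoeff u = 1) : ∃ s : PowerSeries E, s ^ 2 = u := by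
  have hI : Ideal.Quotient.mk (Ideal.span {(PowerSeries.X : PowerSeries E)}) u = 1 := by
    rw [← map_one (Ideal.Quotient.mk _), Ideal.Quotient.mk_eq_mk_iff_sub_mem,
      Ideal.mem_span_singleton, PowerSeries.X_dvd_iff]
    simp [hu]
  have h2 : IsUnit (2 : PowerSeries E) := by
    rw [PowerSeries.isUnit_iff_constantCoeff, map_ofNat]
    exact isUnit_iff_ne_zero.2 two_ne_zero
  -- Modulo `X` the polynomial `T² - u` has the root `1`, which is simple because `2` is invertible.
  obtain ⟨s, hs, -⟩ := HenselianRing.is_henselian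
    (I := Ideal.span {(PowerSeries.X : PowerSeries E)})
    (Polynomial.X ^ 2 - Polynomial.C u) (Polynomial.monic_X_pow_sub_C u two_ne_zero) 1
    (by rw [← Ideal.Quotient.eq_zero_iff_mem]; simp [hI])
    (by
      apply IsUnit.map
      simpa [one_add_one_eq_two] using h2)
  refine ⟨s, ?_⟩
  simpa [Polynomial.IsRoot, sub_eq_zero] using hs

/-- A Laurent series of even order is its leading coefficient times a square. -/
theorem exists_eq_C_leadingCoeff_mul_sq [CharZero E] (x : E⸨X⸩) (hx : x ≠ 0) (p : ℤ)
    (hp : x.order = 2 * p) :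
    ∃ s : E⸨X⸩, x = HahnSeries.C (x.coeff x.order) * s ^ 2 := by
  have hc : x.coeff x.order ≠ 0 := by
    simpa [HahnSeries.leadingCoeff_eq] using HahnSeries.leadingCoeff_ne_zero.mpr hx
  obtain ⟨s, hs⟩ := exists_sq_eq_of_constantCoeff_eq_one
    (PowerSeries.C (x.coeff x.order)⁻¹ * x.powerSeriesPart) (by
      rw [map_mul, ← PowerSeries.coeff_zero_eq_constantCoeff_apply x.powerSeriesPart,
        LaurentSeries.powerSeriesPart_coeff]
      simp [hc])
  refine ⟨HahnSeries.single p 1 * HahnSeries.ofPowerSeries ℤ E s, ?_⟩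
  rw [mul_pow, ← map_pow (HahnSeries.ofPowerSeries ℤ E), hs, map_mul, HahnSeries.ofPowerSeries_C,
    HahnSeries.single_pow]
  conv_lhs => rw [← LaurentSeries.single_order_mul_powerSeriesPart x]
  have h1 : HahnSeries.C (x.coeff x.order) * HahnSeries.C (x.coeff x.order)⁻¹ = (1 : E⸨X⸩) := by
    rw [← map_mul, mul_inv_cancel₀ hc, map_one]
  have h2 : (2 • p : ℤ) = x.order := by rw [hp]; simp
  rw [one_pow, h2]
  calc _ = HahnSeries.C (x.coeff x.order) * HahnSeries.C (x.coeff x.order)⁻¹ *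
        (HahnSeries.single x.order 1 * HahnSeries.ofPowerSeries ℤ E x.powerSeriesPart) := by
        rw [h1, one_mul]
    _ = _ := by ring

/-- Any other pair of indices with sum `p + q` has a member below its bound. Here `p` and `q` are
only lower bounds for the orders, so no case distinction on vanishing is needed later. -/
theorem coeff_mul_add {k l : E⸨X⸩} {p q : ℤ} (hk : ∀ j < p, k.coeff j = 0)
    (hl : ∀ j < q, l.coeff j = 0) : (k * l).coeff (p + q) = k.coeff p * l.coeff q := by
  rw [HahnSeries.coeff_mul, Finset.sum_eq_single (p, q)]
  · rintro ⟨i, j⟩ hij hne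
    simp only [Finset.mem_antidiagonal, HahnSeries.mem_support] at hij
    obtain ⟨hi, hj, hsum⟩ := hij
    have := not_lt.1 (mt (hk i) hi)
    have := not_lt.1 (mt (hl j) hj)
    exact absurd (Prod.ext (by simp only; omega) (by simp only; omega)) hne
  · intro hn
    simp only [Finset.mem_antidiagonal, HahnSeries.mem_support, and_true] at hn
    by_cases h0 : k.coeff p = 0
    · simp [h0]
    · simp [not_not.1 (not_and.1 hn h0)]

/-- The `n`-th coefficient of a Laurent series, as a linear map. -/
def coeffLinear (n : ℤ) : E⸨X⸩ →ₗ[E] E where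
  toFun k := k.coeff n
  map_add' _ _ := HahnSeries.coeff_add
  map_smul' _ _ := by rw [HahnSeries.coeff_smul]; rfl

/-! ### Coefficients of elements of `E((t)) ⊗ V` -/

variable {V V' : Type*} [AddCommGroup V] [Module E V] [AddCommGroup V'] [Module E V']

/-- The `n`-th coefficient of an element of `E((t)) ⊗ V`. -/
def tcoeff (n : ℤ) : E⸨X⸩ ⊗[E] V →ₗ[E] V :=
  TensorProduct.lift ((LinearMap.lsmul E V).comp (coeffLinear n))

@[simp]
theorem tcoeff_tmul (n : ℤ) (k : E⸨X⸩) (v : V) : tcoeff n (k ⊗ₜ[E] v) = k.coeff n • v := rfl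

theorem tcoeff_one_tmul (n : ℤ) (v : V) :
    tcoeff n ((1 : E⸨X⸩) ⊗ₜ[E] v) = if n = 0 then v else 0 := by
  rw [tcoeff_tmul, HahnSeries.coeff_one]
  split_ifs <;> simp

theorem repr_tcoeff {ι : Type*} [DecidableEq ι] (b : Module.Basis ι E V) (n : ℤ) (x : E⸨X⸩ ⊗[E] V) (i : ι) :
    b.repr (tcoeff n x) i = (TensorProduct.equivFinsuppOfBasisRight b x i).coeff n := by
  induction x with
  | zero => simp
  | add x y hx hy => simp [hx, hy]
  | tmul k v =>
    rw [TensorProduct.equivFinsuppOfBasisRight_apply_tmul_apply]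
    simp only [tcoeff_tmul, map_smul, Finsupp.smul_apply, smul_eq_mul]
    exact mul_comm _ _

theorem eq_zero_of_tcoeff_eq_zero {x : E⸨X⸩ ⊗[E] V} (hx : ∀ n, tcoeff n x = 0) : x = 0 := by
  classical
  let b := Module.Basis.ofVectorSpace E V
  apply (TensorProduct.equivFinsuppOfBasisRight b).injective
  ext i n
  rw [← repr_tcoeff, hx]
  simp

theorem exists_tcoeff_eq_zero (x : E⸨X⸩ ⊗[E] V) : ∃ N : ℤ, ∀ j < N, tcoeff j x = 0 := by
  induction x with
  | zero => exact ⟨0, fun j _ => map_zero _⟩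
  | add x y hx hy =>
    obtain ⟨M, hM⟩ := hx
    obtain ⟨N, hN⟩ := hy
    refine ⟨min M N, fun j hj => ?_⟩
    rw [map_add, hM j (by omega), hN j (by omega), add_zero]
  | tmul k v =>
    refine ⟨k.order, fun j hj => ?_⟩
    rw [tcoeff_tmul, HahnSeries.coeff_eq_zero_of_lt_order hj, zero_smul]

/-- Expand `x` in a basis of `V`: the finitely many nonzero coordinate series inherit the vanishing
below `p`. -/
theorem mem_closure_of_tcoeff_eq_zero {p : ℤ} {x : E⸨X⸩ ⊗[E] V} (hx : ∀ j < p, tcoeff j x = 0) :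
    x ∈ AddSubmonoid.closure
      {y | ∃ (k : E⸨X⸩) (v : V), (∀ j < p, k.coeff j = 0) ∧ k ⊗ₜ[E] v = y} := by
  classical
  let b := Module.Basis.ofVectorSpace E V
  rw [← (TensorProduct.equivFinsuppOfBasisRight b).symm_apply_apply x,
    TensorProduct.equivFinsuppOfBasisRight_symm_apply]
  refine sum_mem fun i _ => AddSubmonoid.subset_closure ⟨_, _, fun j hj => ?_, rfl⟩
  rw [← repr_tcoeff, hx j hj]
  simp

/-- Induction principle for the elements of `E((t)) ⊗ V` whose coefficients below `p` vanish. -/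
theorem induction_of_tcoeff_eq_zero {p : ℤ} {P : E⸨X⸩ ⊗[E] V → Prop} (h0 : P 0)
    (hadd : ∀ x y, P x → P y → P (x + y))
    (htmul : ∀ (k : E⸨X⸩) (v : V), (∀ j < p, k.coeff j = 0) → P (k ⊗ₜ v))
    {x : E⸨X⸩ ⊗[E] V} (hx : ∀ j < p, tcoeff j x = 0) : P x := by
  have hmem := mem_closure_of_tcoeff_eq_zero hx
  clear hx
  induction hmem using AddSubmonoid.closure_induction with
  | mem y hy =>
    obtain ⟨k, v, hk, rfl⟩ := hy
    exact htmul k v hk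
  | zero => exact h0
  | add x y _ _ hx hy => exact hadd x y hx hy

theorem tcoeff_add_baseChange {D : Type*} [AddCommGroup D] [Module E D] (B : V →ₗ[E] V →ₗ[E] D)
    {p q : ℤ} {x y : E⸨X⸩ ⊗[E] V} (hx : ∀ j < p, tcoeff j x = 0) (hy : ∀ j < q, tcoeff j y = 0) :
    tcoeff (p + q) (LinearMap.BilinMap.baseChange E⸨X⸩ B x y) = B (tcoeff p x) (tcoeff q y) := by
  refine induction_of_tcoeff_eq_zero (P := fun x =>
    tcoeff (p + q) (LinearMap.BilinMap.baseChange E⸨X⸩ B x y) = B (tcoeff p x) (tcoeff q y))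
    (by simp) (fun x x' h h' => by simp only [map_add, LinearMap.add_apply, h, h'])
    (fun k v hk => ?_) hx
  refine induction_of_tcoeff_eq_zero (P := fun y =>
    tcoeff (p + q) (LinearMap.BilinMap.baseChange E⸨X⸩ B (k ⊗ₜ v) y) =
      B (tcoeff p (k ⊗ₜ v)) (tcoeff q y))
    (by simp) (fun y y' h h' => by simp only [map_add, h, h']) (fun l w hl => ?_) hy
  rw [LinearMap.BilinMap.baseChange_tmul, tcoeff_tmul, tcoeff_tmul, tcoeff_tmul,
    coeff_mul_add hk hl]
  simp [smul_smul, mul_comm]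

theorem tcoeff_baseChange_eq_zero {D : Type*} [AddCommGroup D] [Module E D]
    (B : V →ₗ[E] V →ₗ[E] D) {p q n : ℤ} {x y : E⸨X⸩ ⊗[E] V} (hx : ∀ j < p, tcoeff j x = 0)
    (hy : ∀ j < q, tcoeff j y = 0) (hn : n < p + q) :
    tcoeff n (LinearMap.BilinMap.baseChange E⸨X⸩ B x y) = 0 := by
  -- As `n - q < p`, the bound on `x` may be weakened to `n - q`, where the coefficient of `x` is
  -- still zero.
  have h := tcoeff_add_baseChange B (p := n - q) (fun j hj => hx j (by omega)) hy
  rw [hx (n - q) (by omega), map_zero, LinearMap.zero_apply, sub_add_cancel] at h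
  exact h

theorem tcoeff_add_smul {k : E⸨X⸩} {p q : ℤ} {x : E⸨X⸩ ⊗[E] V} (hk : ∀ j < p, k.coeff j = 0)
    (hx : ∀ j < q, tcoeff j x = 0) : tcoeff (p + q) (k • x) = k.coeff p • tcoeff q x := by
  refine induction_of_tcoeff_eq_zero (P := fun x => tcoeff (p + q) (k • x) =
    k.coeff p • tcoeff q x) (by simp) (fun x x' h h' => by simp only [map_add, smul_add, h, h'])
    (fun l v hl => ?_) hx
  rw [TensorProduct.smul_tmul', smul_eq_mul, tcoeff_tmul, tcoeff_tmul, coeff_mul_add hk hl,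
    mul_smul]

theorem tcoeff_smul_eq_zero {k : E⸨X⸩} {p q n : ℤ} {x : E⸨X⸩ ⊗[E] V}
    (hk : ∀ j < p, k.coeff j = 0) (hx : ∀ j < q, tcoeff j x = 0) (hn : n < p + q) :
    tcoeff n (k • x) = 0 := by
  have h := tcoeff_add_smul (q := n - p) hk (fun j hj => hx j (by omega))
  rw [hx (n - p) (by omega), smul_zero, add_sub_cancel] at h
  exact h

theorem tcoeff_single_smul (m n : ℤ) (x : E⸨X⸩ ⊗[E] V) :
    tcoeff n ((HahnSeries.single m (1 : E) : E⸨X⸩) • x) = tcoeff (n - m) x := by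
  induction x with
  | zero => simp
  | add x y hx hy => simp only [smul_add, map_add, hx, hy]
  | tmul k v =>
    rw [TensorProduct.smul_tmul', smul_eq_mul, tcoeff_tmul, tcoeff_tmul,
      HahnSeries.coeff_single_mul, one_mul]

section Action

variable {Q : Type*} [Ring Q] [Algebra E Q] [Module Q V] [IsScalarTower E Q V]
  [Module Q V'] [IsScalarTower E Q V']

theorem tcoeff_tmul_smul (n : ℤ) (d : Q) (x : E⸨X⸩ ⊗[E] V) :
    tcoeff n (((1 : E⸨X⸩) ⊗ₜ[E] d) • x) = d • tcoeff n x := by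
  induction x with
  | zero => simp
  | add x y hx hy => simp only [smul_add, map_add, hx, hy]
  | tmul k v =>
    have := IsScalarTower.to_smulCommClass (R := E) (A := Q) (M := V)
    rw [scalarExt_tmul_smul_tmul, one_mul, tcoeff_tmul, tcoeff_tmul, smul_comm]

/-- The `n`-th coefficient of a linear map `E((t)) ⊗ V → E((t)) ⊗ V'`, restricted to `V`. -/
def mapCoeff (n : ℤ) (f : (E⸨X⸩ ⊗[E] V) →ₗ[E⸨X⸩ ⊗[E] Q] (E⸨X⸩ ⊗[E] V')) : V →ₗ[Q] V' where
  toFun v := tcoeff n (f (1 ⊗ₜ v))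
  map_add' v w := by rw [TensorProduct.tmul_add, map_add, map_add]
  map_smul' d v := by
    have h : (1 : E⸨X⸩) ⊗ₜ[E] (d • v) = ((1 : E⸨X⸩) ⊗ₜ[E] d) • ((1 : E⸨X⸩) ⊗ₜ[E] v) := by
      rw [scalarExt_tmul_smul_tmul, one_mul]
    rw [h, map_smul, tcoeff_tmul_smul, RingHom.id_apply]

end Action

/-! ### The filtration of `W` -/

/-- The `n`-th step of the filtration of `V((t)) ⊕ V'((t))` in which the coefficients at `t ^ j`
have level `2 j` in the first summand and level `2 j + 1` in the second. -/
def Filt (n : ℤ) (w : (E⸨X⸩ ⊗[E] V) × (E⸨X⸩ ⊗[E] V')) : Prop :=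
  (∀ j, 2 * j < n → tcoeff j w.1 = 0) ∧ (∀ j, 2 * j + 1 < n → tcoeff j w.2 = 0)

theorem exists_filt (w : (E⸨X⸩ ⊗[E] V) × (E⸨X⸩ ⊗[E] V')) : ∃ n, Filt n w := by
  obtain ⟨M, hM⟩ := exists_tcoeff_eq_zero w.1
  obtain ⟨N, hN⟩ := exists_tcoeff_eq_zero w.2
  exact ⟨min (2 * M) (2 * N), fun j hj => hM j (by omega), fun j hj => hN j (by omega)⟩

theorem filt_inl (v : V) : Filt 0 (((1 : E⸨X⸩) ⊗ₜ[E] v, 0) : (E⸨X⸩ ⊗[E] V) × (E⸨X⸩ ⊗[E] V')) :=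
  ⟨fun j hj => by rw [tcoeff_one_tmul, if_neg (by omega)], fun j _ => map_zero _⟩

theorem filt_inr (v : V') : Filt 1 ((0, (1 : E⸨X⸩) ⊗ₜ[E] v) : (E⸨X⸩ ⊗[E] V) × (E⸨X⸩ ⊗[E] V')) :=
  ⟨fun j _ => map_zero _, fun j hj => by rw [tcoeff_one_tmul, if_neg (by omega)]⟩

/-- Removing the leading term raises the level by one. -/
theorem filt_sub_inl {q : ℤ} {w : (E⸨X⸩ ⊗[E] V) × (E⸨X⸩ ⊗[E] V')} (hw : Filt (2 * q) w) :
    Filt (2 * q + 1) (w - (HahnSeries.single q (1 : E) : E⸨X⸩) •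
      ((1 : E⸨X⸩) ⊗ₜ[E] tcoeff q w.1, (0 : E⸨X⸩ ⊗[E] V'))) := by
  refine ⟨fun j hj => ?_, fun j hj => ?_⟩
  · rw [Prod.fst_sub, Prod.smul_fst, map_sub, tcoeff_single_smul, tcoeff_one_tmul]
    split_ifs with h
    · rw [show j = q by omega, sub_self]
    · rw [hw.1 j (by omega), sub_zero]
  · rw [Prod.snd_sub, Prod.smul_snd, smul_zero, sub_zero, hw.2 j (by omega)]

theorem filt_sub_inr {q : ℤ} {w : (E⸨X⸩ ⊗[E] V) × (E⸨X⸩ ⊗[E] V')} (hw : Filt (2 * q + 1) w) :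
    Filt (2 * q + 2) (w - (HahnSeries.single q (1 : E) : E⸨X⸩) •
      ((0 : E⸨X⸩ ⊗[E] V), (1 : E⸨X⸩) ⊗ₜ[E] tcoeff q w.2)) := by
  refine ⟨fun j hj => ?_, fun j hj => ?_⟩
  · rw [Prod.fst_sub, Prod.smul_fst, smul_zero, sub_zero, hw.1 j (by omega)]
  · rw [Prod.snd_sub, Prod.smul_snd, map_sub, tcoeff_single_smul, tcoeff_one_tmul]
    split_ifs with h
    · rw [show j = q by omega, sub_self]
    · rw [hw.2 j (by omega), sub_zero]

/-! ### Graded maps of an endomorphism shifting the filtration by `m` -/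

section Shift

variable {Q : Type*} [Ring Q] [Algebra E Q] [Module Q V] [IsScalarTower E Q V]
  [Module Q V'] [IsScalarTower E Q V']
  {g : Module.End (E⸨X⸩ ⊗[E] Q) ((E⸨X⸩ ⊗[E] V) × (E⸨X⸩ ⊗[E] V'))} {m q : ℤ}
  {w : (E⸨X⸩ ⊗[E] V) × (E⸨X⸩ ⊗[E] V')}

theorem filt_apply_sub_inl (hg : ∀ n w, Filt n w → Filt (n + m) (g w)) (hw : Filt (2 * q) w) :
    Filt (2 * q + 1 + m) (g w - (HahnSeries.single q (1 : E) : E⸨X⸩) •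
      g ((1 : E⸨X⸩) ⊗ₜ[E] tcoeff q w.1, (0 : E⸨X⸩ ⊗[E] V'))) := by
  have h := hg _ _ (filt_sub_inl hw)
  rwa [map_sub, LinearMap.map_smul_of_tower] at h

theorem filt_apply_sub_inr (hg : ∀ n w, Filt n w → Filt (n + m) (g w)) (hw : Filt (2 * q + 1) w) :
    Filt (2 * q + 2 + m) (g w - (HahnSeries.single q (1 : E) : E⸨X⸩) •
      g ((0 : E⸨X⸩ ⊗[E] V), (1 : E⸨X⸩) ⊗ₜ[E] tcoeff q w.2)) := by
  have h := hg _ _ (filt_sub_inr hw)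
  rwa [map_sub, LinearMap.map_smul_of_tower] at h

/-- The coefficient has level `2n = 2q + m`, just below the level of `g` applied to `w` minus its
leading term; so only the leading term contributes. -/
theorem tcoeff_apply_fst_of_even {n p : ℤ} (hg : ∀ n w, Filt n w → Filt (n + m) (g w))
    (hw : Filt (2 * q) w) (hm : m = 2 * p) (hn : n = p + q) :
    tcoeff n (g w).1 =
      mapCoeff p (LinearMap.fst _ _ _ ∘ₗ g ∘ₗ LinearMap.inl _ _ _) (tcoeff q w.1) := by
  have h := (filt_apply_sub_inl hg hw).1 n (by omega)
  rw [Prod.fst_sub, Prod.smul_fst, map_sub, tcoeff_single_smul, sub_eq_zero] at h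
  rw [h, show n - q = p by omega]
  rfl

theorem tcoeff_apply_snd_of_even {n p : ℤ} (hg : ∀ n w, Filt n w → Filt (n + m) (g w))
    (hw : Filt (2 * q + 1) w) (hm : m = 2 * p) (hn : n = p + q) :
    tcoeff n (g w).2 =
      mapCoeff p (LinearMap.snd _ _ _ ∘ₗ g ∘ₗ LinearMap.inr _ _ _) (tcoeff q w.2) := by
  have h := (filt_apply_sub_inr hg hw).2 n (by omega)
  rw [Prod.snd_sub, Prod.smul_snd, map_sub, tcoeff_single_smul, sub_eq_zero] at h
  rw [h, show n - q = p by omega]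
  rfl

theorem tcoeff_apply_snd_of_odd {n p : ℤ} (hg : ∀ n w, Filt n w → Filt (n + m) (g w))
    (hw : Filt (2 * q) w) (hm : m = 2 * p + 1) (hn : n = p + q) :
    tcoeff n (g w).2 =
      mapCoeff p (LinearMap.snd _ _ _ ∘ₗ g ∘ₗ LinearMap.inl _ _ _) (tcoeff q w.1) := by
  have h := (filt_apply_sub_inl hg hw).2 n (by omega)
  rw [Prod.snd_sub, Prod.smul_snd, map_sub, tcoeff_single_smul, sub_eq_zero] at h
  rw [h, show n - q = p by omega]
  rfl

/-- The index is `p + 1` because the levels add to `(2q + 1) + (2p + 1) = 2(p + 1 + q)`. -/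
theorem tcoeff_apply_fst_of_odd {n p : ℤ} (hg : ∀ n w, Filt n w → Filt (n + m) (g w))
    (hw : Filt (2 * q + 1) w) (hm : m = 2 * p + 1) (hn : n = p + 1 + q) :
    tcoeff n (g w).1 =
      mapCoeff (p + 1) (LinearMap.fst _ _ _ ∘ₗ g ∘ₗ LinearMap.inr _ _ _) (tcoeff q w.2) := by
  have h := (filt_apply_sub_inr hg hw).1 n (by omega)
  rw [Prod.fst_sub, Prod.smul_fst, map_sub, tcoeff_single_smul, sub_eq_zero] at h
  rw [h, show n - q = p + 1 by omega]
  rfl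

end Shift

end LaurentSeries

/-! ### Leading coefficients of `h_W` and anisotropy -/

namespace SkewHermitianForm

open LaurentSeries

variable {E Q V V' : Type*} [Field E] [Ring Q] [Algebra E Q] {σ : Q →ₗ[E] Q}
  [AddCommGroup V] [Module E V] [Module Q V] [IsScalarTower E Q V]
  [AddCommGroup V'] [Module E V'] [Module Q V'] [IsScalarTower E Q V']
  (h : SkewHermitianForm E V σ) (h' : SkewHermitianForm E V' σ)

theorem tcoeff_laurentSum (n : ℤ) (w₁ w₂ : (E⸨X⸩ ⊗[E] V) × (E⸨X⸩ ⊗[E] V')) :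
    tcoeff n ((h.laurentSum h').form w₁ w₂) =
      tcoeff n (LinearMap.BilinMap.baseChange E⸨X⸩ h.form w₁.1 w₂.1) +
        tcoeff (n - 1) (LinearMap.BilinMap.baseChange E⸨X⸩ h'.form w₁.2 w₂.2) := by
  rw [← tcoeff_single_smul 1, ← map_add]
  rfl

variable {w₁ w₂ : (E⸨X⸩ ⊗[E] V) × (E⸨X⸩ ⊗[E] V')}

theorem tcoeff_laurentSum_eq_zero {a b n : ℤ} (h₁ : Filt a w₁) (h₂ : Filt b w₂)
    (hn : 2 * n < a + b) : tcoeff n ((h.laurentSum h').form w₁ w₂) = 0 := by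
  rw [tcoeff_laurentSum,
    -- Level `a` means order at least `⌈a/2⌉` in the first summand and at least `⌊a/2⌋` in the
    -- second.
    tcoeff_baseChange_eq_zero h.form (p := (a + 1) / 2) (q := (b + 1) / 2)
      (fun j hj => h₁.1 j (by omega)) (fun j hj => h₂.1 j (by omega)) (by omega),
    tcoeff_baseChange_eq_zero h'.form (p := a / 2) (q := b / 2)
      (fun j hj => h₁.2 j (by omega)) (fun j hj => h₂.2 j (by omega)) (by omega), add_zero]

theorem tcoeff_laurentSum_of_even {p q n : ℤ} (h₁ : Filt (2 * p) w₁) (h₂ : Filt (2 * q) w₂)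
    (hn : n = p + q) :
    tcoeff n ((h.laurentSum h').form w₁ w₂) = h.form (tcoeff p w₁.1) (tcoeff q w₂.1) := by
  subst hn
  rw [tcoeff_laurentSum,
    tcoeff_add_baseChange h.form (fun j hj => h₁.1 j (by omega)) (fun j hj => h₂.1 j (by omega)),
    tcoeff_baseChange_eq_zero h'.form (p := p) (q := q)
      (fun j hj => h₁.2 j (by omega)) (fun j hj => h₂.2 j (by omega)) (by omega), add_zero]

theorem tcoeff_laurentSum_of_odd {p q n : ℤ} (h₁ : Filt (2 * p + 1) w₁)
    (h₂ : Filt (2 * q + 1) w₂) (hn : n = p + q + 1) :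
    tcoeff n ((h.laurentSum h').form w₁ w₂) = h'.form (tcoeff p w₁.2) (tcoeff q w₂.2) := by
  rw [tcoeff_laurentSum, show n - 1 = p + q by omega,
    tcoeff_add_baseChange h'.form (fun j hj => h₁.2 j (by omega)) (fun j hj => h₂.2 j (by omega)),
    tcoeff_baseChange_eq_zero h.form (p := p + 1) (q := q + 1)
      (fun j hj => h₁.1 j (by omega)) (fun j hj => h₂.1 j (by omega)) (by omega), zero_add]

variable {h h'}

/-- For anisotropic `h` and `h'`, the level of `w` is the order of `h_W(w, w)`. -/
theorem filt_of_tcoeff_laurentSum_eq_zero (ha : h.Anisotropic) (ha' : h'.Anisotropic) {n : ℤ}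
    {w : (E⸨X⸩ ⊗[E] V) × (E⸨X⸩ ⊗[E] V')}
    (hw : ∀ j < n, tcoeff j ((h.laurentSum h').form w w) = 0) : Filt n w := by
  obtain ⟨N, hN⟩ := exists_filt w
  -- Climb one level at a time: the coefficient of `h_W(w, w)` at `t ^ k` is `h` or `h'` at the
  -- level-`k` coefficient of `w`, which anisotropy forces to vanish.
  have key : ∀ k, N ≤ k → k ≤ n → Filt k w := by
    intro k hk
    induction k, hk using Int.leInduction with
    | base => exact fun _ => hN
    | succ k hk ih =>
      intro hkn
      have hF := ih (by omega)
      obtain ⟨p, hp | hp⟩ := Int.even_or_odd' k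
      · subst hp
        have hz := hw (2 * p) (by omega)
        rw [tcoeff_laurentSum_of_even h h' hF hF (two_mul p)] at hz
        refine ⟨fun j hj => ?_, fun j hj => hF.2 j (by omega)⟩
        rcases eq_or_ne j p with rfl | hne
        · exact ha _ hz
        · exact hF.1 j (by omega)
      · subst hp
        have hz := hw (2 * p + 1) (by omega)
        rw [tcoeff_laurentSum_of_odd h h' hF hF (by omega)] at hz
        refine ⟨fun j hj => hF.1 j (by omega), fun j hj => ?_⟩
        rcases eq_or_ne j p with rfl | hne
        · exact ha' _ hz
        · exact hF.2 j (by omega)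
  rcases le_total N n with hNn | hNn
  · exact key n hNn le_rfl
  · exact ⟨fun j hj => hN.1 j (by omega), fun j hj => hN.2 j (by omega)⟩

theorem laurentSum_anisotropic (ha : h.Anisotropic) (ha' : h'.Anisotropic) :
    (h.laurentSum h').Anisotropic := by
  intro w hw
  have hF : ∀ n, Filt n w := fun n =>
    filt_of_tcoeff_laurentSum_eq_zero ha ha' fun j _ => by rw [hw, map_zero]
  exact Prod.ext (eq_zero_of_tcoeff_eq_zero fun j => (hF (2 * j + 1)).1 j (by omega))
    (eq_zero_of_tcoeff_eq_zero fun j => (hF (2 * j + 2)).2 j (by omega))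

/-! ### Symmetric endomorphisms with scalar square -/

section Similitude

variable {g : Module.End (E⸨X⸩ ⊗[E] Q) ((E⸨X⸩ ⊗[E] V) × (E⸨X⸩ ⊗[E] V'))} {lam : E⸨X⸩}

theorem laurentSum_form_apply_apply (hg : (h.laurentSum h').AdSymmetric g)
    (hsq : ∀ w, g (g w) = lam • w) (w₁ w₂ : (E⸨X⸩ ⊗[E] V) × (E⸨X⸩ ⊗[E] V')) :
    (h.laurentSum h').form (g w₁) (g w₂) = lam • (h.laurentSum h').form w₁ w₂ := by
  have := hg w₁ (g w₂)
  rw [hsq, map_smul] at this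
  exact this

/-- `h_W(gw, gw) = λ h_W(w, w)` has order at least `n + m`, and anisotropy converts this order back
into a level. -/
theorem filt_apply (ha : h.Anisotropic) (ha' : h'.Anisotropic)
    (hg : (h.laurentSum h').AdSymmetric g) (hsq : ∀ w, g (g w) = lam • w) {m : ℤ}
    (hm : ∀ j < m, lam.coeff j = 0) (n : ℤ) (w : (E⸨X⸩ ⊗[E] V) × (E⸨X⸩ ⊗[E] V'))
    (hw : Filt n w) : Filt (n + m) (g w) := by
  refine filt_of_tcoeff_laurentSum_eq_zero ha ha' fun j hj => ?_
  rw [laurentSum_form_apply_apply hg hsq]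
  exact tcoeff_smul_eq_zero hm
    (fun i hi => tcoeff_laurentSum_eq_zero h h' hw hw (by omega)) (by omega : j < m + n)

theorem tcoeff_smul_one_tmul {U : Type*} [AddCommGroup U] [Module E U] {m : ℤ}
    (hm : ∀ j < m, lam.coeff j = 0) (u : U) :
    tcoeff m (lam • ((1 : E⸨X⸩) ⊗ₜ[E] u)) = lam.coeff m • u := by
  have := tcoeff_add_smul (q := 0) (x := (1 : E⸨X⸩) ⊗ₜ[E] u) hm
    fun j hj => by rw [tcoeff_one_tmul, if_neg hj.ne]
  rwa [add_zero, tcoeff_one_tmul, if_pos rfl] at this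

/-- If the multiplier has odd order, the graded map `V → V'` is a similitude. -/
theorem similar_of_order_odd (ha : h.Anisotropic) (ha' : h'.Anisotropic)
    (hg : (h.laurentSum h').AdSymmetric g) (hsq : ∀ w, g (g w) = lam • w) {m p : ℤ}
    (hm : ∀ j < m, lam.coeff j = 0) (hm0 : lam.coeff m ≠ 0) (hp : m = 2 * p + 1) :
    h.Similar h' := by
  have hF := filt_apply ha ha' hg hsq hm
  set f : V →ₗ[Q] V' := mapCoeff p (LinearMap.snd _ _ _ ∘ₗ g ∘ₗ LinearMap.inl _ _ _)
  set f' : V' →ₗ[Q] V := mapCoeff (p + 1) (LinearMap.fst _ _ _ ∘ₗ g ∘ₗ LinearMap.inr _ _ _)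
  have h₁ : ∀ v, Filt (2 * p + 1) (g ((1 : E⸨X⸩) ⊗ₜ[E] v, (0 : E⸨X⸩ ⊗[E] V'))) := fun v => by
    simpa [hp] using hF _ _ (filt_inl v)
  have h₂ : ∀ v, Filt (2 * (p + 1)) (g ((0 : E⸨X⸩ ⊗[E] V), (1 : E⸨X⸩) ⊗ₜ[E] v)) := fun v => by
    convert hF _ _ (filt_inr v) using 1
    omega
  -- The coefficient of `g² = λ` at `t ^ m` makes `f` and `f'` mutually inverse up to the scalar
  -- `λ_m`.
  have hf'f : ∀ v, f' (f v) = lam.coeff m • v := fun v => by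
    have := tcoeff_apply_fst_of_odd (n := m) hF (h₁ v) hp (by omega)
    rw [hsq, Prod.smul_fst, tcoeff_smul_one_tmul hm] at this
    exact this.symm
  have hff' : ∀ v, f (f' v) = lam.coeff m • v := fun v => by
    have := tcoeff_apply_snd_of_odd (n := m) hF (h₂ v) hp (by omega)
    rw [hsq, Prod.smul_snd, tcoeff_smul_one_tmul hm] at this
    exact this.symm
  have hbij : Function.Bijective f := by
    constructor
    · refine (injective_iff_map_eq_zero f).2 fun v hv => ?_
      have := hf'f v
      rw [hv, map_zero] at this
      exact (smul_eq_zero.1 this.symm).resolve_left hm0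
    · intro v
      refine ⟨f' ((lam.coeff m)⁻¹ • v), ?_⟩
      rw [hff', smul_smul, mul_inv_cancel₀ hm0, one_smul]
  refine ⟨Units.mk0 _ hm0, LinearEquiv.ofBijective f hbij, fun x y => ?_⟩
  -- Compare both sides of `h_W(gx, gy) = λ h_W(x, y)` at `t ^ m`: the left gives `h'(fx, fy)`, the
  -- right `λ_m h(x, y)`.
  have e₁ := tcoeff_laurentSum_of_odd h h' (n := m) (h₁ x) (h₁ y) (by omega)
  rw [laurentSum_form_apply_apply hg hsq] at e₁
  have e₂ := tcoeff_add_smul (q := 0) hm (fun j hj =>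
    tcoeff_laurentSum_eq_zero h h' (filt_inl (V' := V') x) (filt_inl y) (by omega : 2 * j < 0 + 0))
  rw [add_zero, tcoeff_laurentSum_of_even h h' (p := 0) (q := 0) (filt_inl x) (filt_inl y)
    (add_zero 0).symm,
    tcoeff_one_tmul, tcoeff_one_tmul, if_pos rfl, if_pos rfl] at e₂
  exact e₁.symm.trans e₂

/-- If the multiplier has even order, the graded maps are symmetric and square to its leading
coefficient. -/
theorem exists_adSymmetric_of_order_even (ha : h.Anisotropic) (ha' : h'.Anisotropic)
    (hg : (h.laurentSum h').AdSymmetric g) (hsq : ∀ w, g (g w) = lam • w) {m p : ℤ}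
    (hm : ∀ j < m, lam.coeff j = 0) (hp : m = 2 * p) :
    ∃ (f : Module.End Q V) (f' : Module.End Q V'), h.AdSymmetric f ∧ h'.AdSymmetric f' ∧
      (∀ v, f (f v) = lam.coeff m • v) ∧ ∀ v, f' (f' v) = lam.coeff m • v := by
  have hF := filt_apply ha ha' hg hsq hm
  have h₁ : ∀ v, Filt (2 * p) (g ((1 : E⸨X⸩) ⊗ₜ[E] v, (0 : E⸨X⸩ ⊗[E] V'))) := fun v => by
    simpa [hp] using hF _ _ (filt_inl v)
  have h₂ : ∀ v, Filt (2 * p + 1) (g ((0 : E⸨X⸩ ⊗[E] V), (1 : E⸨X⸩) ⊗ₜ[E] v)) := fun v => by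
    convert hF _ _ (filt_inr v) using 1
    omega
  refine ⟨mapCoeff p (LinearMap.fst _ _ _ ∘ₗ g ∘ₗ LinearMap.inl _ _ _),
    mapCoeff p (LinearMap.snd _ _ _ ∘ₗ g ∘ₗ LinearMap.inr _ _ _),
    fun x y => ?_, fun x y => ?_, fun v => ?_, fun v => ?_⟩
  · have e₁ := tcoeff_laurentSum_of_even h h' (n := p) (q := 0) (h₁ x) (filt_inl y) (by omega)
    have e₂ := tcoeff_laurentSum_of_even h h' (n := p) (p := 0) (filt_inl x) (h₁ y) (by omega)
    rw [tcoeff_one_tmul, if_pos rfl] at e₁ e₂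
    exact e₁.symm.trans ((congrArg (tcoeff p) (hg _ _)).trans e₂)
  -- The symmetry of `g` is read at `t ^ (p + 1)` instead of `t ^ p` because of the factor `t` on
  -- `h'`.
  · have e₁ := tcoeff_laurentSum_of_odd h h' (n := p + 1) (q := 0) (h₂ x) (filt_inr y) (by omega)
    have e₂ := tcoeff_laurentSum_of_odd h h' (n := p + 1) (p := 0) (filt_inr x) (h₂ y) (by omega)
    rw [tcoeff_one_tmul, if_pos rfl] at e₁ e₂
    exact e₁.symm.trans ((congrArg (tcoeff (p + 1)) (hg _ _)).trans e₂)
  · have := tcoeff_apply_fst_of_even (n := m) hF (h₁ v) hp (by omega)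
    rw [hsq, Prod.smul_fst, tcoeff_smul_one_tmul hm] at this
    exact this.symm
  · have := tcoeff_apply_snd_of_even (n := m) hF (h₂ v) hp (by omega)
    rw [hsq, Prod.smul_snd, tcoeff_smul_one_tmul hm] at this
    exact this.symm

end Similitude

end SkewHermitianForm

end

theorem proposition5p1 {E Q V V' : Type*} [Field E] [CharZero E]
    [DivisionRing Q] [Algebra E Q] {a b : E} (φ : Q ≃ₐ[E] ℍ[E, a, b])
    [AddCommGroup V] [Module E V] [Module Q V] [IsScalarTower E Q V] [Module.Finite Q V]
    [AddCommGroup V'] [Module E V'] [Module Q V'] [IsScalarTower E Q V'] [Module.Finite Q V']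
    (h : SkewHermitianForm E V (quatConj φ)) (h' : SkewHermitianForm E V' (quatConj φ)) :
    (h.Anisotropic → h'.Anisotropic → (h.laurentSum h').Anisotropic) ∧
    (h.Anisotropic → h'.Anisotropic → ¬ h.Similar h' →
      ∀ (gW : Module.End (ScalarExt E E⸨X⸩ Q) (ScalarExt E E⸨X⸩ V × ScalarExt E E⸨X⸩ V')) (lam : E⸨X⸩ˣ),
        (h.laurentSum h').AdSymmetric gW →
        gW ^ 2 = algebraMap E⸨X⸩ (Module.End (ScalarExt E E⸨X⸩ Q) _) (lam : E⸨X⸩) →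
        ∃ (lam₀ : Eˣ) (g : Module.End Q V) (g' : Module.End Q V'),
          (∃ s : E⸨X⸩ˣ, (lam : E⸨X⸩) = algebraMap E E⸨X⸩ (lam₀ : E) * (s : E⸨X⸩) ^ 2) ∧
          h.AdSymmetric g ∧ h'.AdSymmetric g' ∧
          g ^ 2 = algebraMap E (Module.End Q V) (lam₀ : E) ∧
          g' ^ 2 = algebraMap E (Module.End Q V') (lam₀ : E)) := by
  refine ⟨SkewHermitianForm.laurentSum_anisotropic, fun ha ha' hns gW lam hg hsq => ?_⟩
  have hsq' : ∀ w, gW (gW w) = (lam : E⸨X⸩) • w := fun w => LinearMap.congr_fun hsq w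
  have hm : ∀ j < (lam : E⸨X⸩).order, (lam : E⸨X⸩).coeff j = 0 :=
    fun j hj => HahnSeries.coeff_eq_zero_of_lt_order hj
  have hm0 : (lam : E⸨X⸩).coeff (lam : E⸨X⸩).order ≠ 0 := by
    simp [← HahnSeries.leadingCoeff_eq]
  obtain ⟨p, hp | hp⟩ := Int.even_or_odd' (lam : E⸨X⸩).order
  · obtain ⟨g, g', hgs, hgs', hg2, hg2'⟩ :=
      SkewHermitianForm.exists_adSymmetric_of_order_even ha ha' hg hsq' hm hp
    obtain ⟨s, hs⟩ := LaurentSeries.exists_eq_C_leadingCoeff_mul_sq _ lam.ne_zero p hp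
    have hs0 : s ≠ 0 := by
      rintro rfl
      exact lam.ne_zero (by rw [hs]; simp)
    exact ⟨Units.mk0 _ hm0, g, g', ⟨Units.mk0 s hs0, hs⟩, hgs, hgs',
      LinearMap.ext hg2, LinearMap.ext hg2'⟩
  · exact absurd (SkewHermitianForm.similar_of_order_odd ha ha' hg hsq' hm hm0 hp) hns
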